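/- Let $R$ be an associative unital ring that is left noetherian; modules are left $R$-modules, and an $R$-complex is a (homologically indexed, possibly unbounded) chain complex $M=(\cdots\to M_{i+1}\to M_i\to M_{i-1}\to\cdots)_{i\in\mathbb{Z}}$ of $R$-modules. Definitions. An exact sequence $0\to L\to M\to N\to 0$ of $R$-modules is *pure* if $\operatorname{Hom}_R(A,-)$ keeps it exact for every finitely presented $R$-module $A$. An exact sequence $0\to L\to M\to N\to 0$ of $R$-complexes is *pure* if for every bounded complex $A$ of finitely presented $R$-modules it remains exact after applying the functor $\operatorname{Hom}_{\mathcal C(R)}(A,-)$ of chain maps from $A$; a subcomplex $L\subseteq M$ is *pure* if $0\to L\to M\to M/L\to 0$ is pure. With $Z_i(M)=\operatorname{Ker}(M_i\to M_{i-1})$, a complex $M$ is *pure-acyclic* if it is acyclic and each exact sequence $0\to Z_i(M)\to M_i\to Z_{i-1}(M)\to 0$ is pure. A complex is *pure-minimal* if the zero complex is its only pure-acyclic pure subcomplex. A complex $P$ is *semi-projective* if every $P_i$ is projective and the total Hom complex $\operatorname{Hom}_R(P,A)$ is acyclic for every acyclic $R$-complex $A$. A *semi-projective resolution* of $M$ is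 a quasi-isomorphism $P\to M$ with $P$ semi-projective. The *projective dimension* $\operatorname{pd} M\in\mathbb{Z}\cup\{\pm\infty\}$ is the infimum of the integers $n$ for which $M$ has a semi-projective resolution $P\to M$ with $P_i=0$ for all $i>n$. A complex is *degreewise finitely generated* if its module in each degree is finitely generated. Conventions: $\inf\varnothing=\infty$ and $\sup\varnothing=-\infty$. Theorem. Let $R$ be left noetherian and let $M$ be an $R$-complex such that $H_i(M)$ is finitely generated for every $i\in\mathbb{Z}$ and $H_i(M)=0$ for all $i\ll 0$. Then there is a semi-projective resolution $L\to M$ with $L$ pure-minimal and degreewise finitely generated. Furthermore, for every semi-projective resolution $L\to M$ with $L$ pure-minimal and degreewise finitely generated, $$\operatorname{pd} M=\sup\{\,i\in\mathbb{Z} : L_i\neq 0\,\}.$$ -/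

import Mathlib

open CategoryTheory CategoryTheory.Limits

universe v u

namespace PureMin

/-- A sequence `0 → L → M → N → 0` of left `R`-modules is pure exact if it is exact and
remains exact after applying `Hom_R(A, -)` for every finitely presented `R`-module `A`. -/
def PureShortExact {R : Type u} [Ring R] (S : ShortComplex (ModuleCat.{v} R)) : Prop :=
  S.ShortExact ∧ ∀ A : ModuleCat.{v} R, Module.FinitePresentation R A →
    (S.map (preadditiveCoyoneda.obj (Opposite.op A))).ShortExact

/-- A bounded complex of finitely presented modules. -/
def IsBoundedFinPres {R : Type u} [Ring R] (A : ChainComplex (ModuleCat.{v} R) ℤ) : Prop :=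
  (∃ a b : ℤ, ∀ i : ℤ, (i < a ∨ b < i) → IsZero (A.X i)) ∧
    ∀ i : ℤ, Module.FinitePresentation R (A.X i)

/-- A sequence `0 → L → M → N → 0` of `R`-complexes is pure exact if it is exact and remains
exact after applying the functor of chain maps out of `A`, for every bounded complex `A` of
finitely presented `R`-modules. -/
def PureShortExactComplex {R : Type u} [Ring R]
    (S : ShortComplex (ChainComplex (ModuleCat.{v} R) ℤ)) : Prop :=
  S.ShortExact ∧ ∀ A : ChainComplex (ModuleCat.{v} R) ℤ, IsBoundedFinPres A →
    (S.map (preadditiveCoyoneda.obj (Opposite.op A))).ShortExact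

/-- The sequence `0 → Z_i(M) → M_i → Z_{i-1}(M)`. -/
noncomputable def cyclesSequence {R : Type u} [Ring R] (M : ChainComplex (ModuleCat.{v} R) ℤ)
    (i : ℤ) : ShortComplex (ModuleCat.{v} R) :=
  ShortComplex.mk (M.iCycles i) (M.toCycles i (i - 1)) (by
    rw [← cancel_mono (M.iCycles (i - 1)), Category.assoc, HomologicalComplex.toCycles_i,
      HomologicalComplex.iCycles_d, zero_comp])

/-- A complex is pure-acyclic if it is acyclic and all sequences
`0 → Z_i(M) → M_i → Z_{i-1}(M) → 0` are pure exact. -/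
def IsPureAcyclic {R : Type u} [Ring R] (M : ChainComplex (ModuleCat.{v} R) ℤ) : Prop :=
  M.Acyclic ∧ ∀ i : ℤ, PureShortExact (cyclesSequence M i)

/-- The sequence `L → M → M/L` attached to a morphism of complexes `L → M`
(used for the inclusion of a subcomplex). -/
noncomputable def quotientSequence {R : Type u} [Ring R]
    {L M : ChainComplex (ModuleCat.{v} R) ℤ} (j : L ⟶ M) :
    ShortComplex (ChainComplex (ModuleCat.{v} R) ℤ) :=
  ShortComplex.mk j (cokernel.π j) (cokernel.condition j)

/-- A complex is pure-minimal if its only pure-acyclic pure subcomplex is zero.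
A subcomplex is given by the injective chain map `j : P → M` that includes it. -/
def IsPureMinimal {R : Type u} [Ring R] (M : ChainComplex (ModuleCat.{v} R) ℤ) : Prop :=
  ∀ (P : ChainComplex (ModuleCat.{v} R) ℤ) (j : P ⟶ M), Mono j →
    PureShortExactComplex (quotientSequence j) → IsPureAcyclic P → IsZero P

/-- The total Hom complex of two `R`-complexes. Mathlib's `HomComplex` is stated for
cohomological indexing, so both complexes are first reindexed by `i ↦ -i`; its term in degree
`n` is the product over `p` of the groups of homomorphisms from `P_p` to `A_{p-n}`. -/
noncomputable def totalHom {R : Type u} [Ring R] (P A : ChainComplex (ModuleCat.{v} R) ℤ) :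
    CochainComplex AddCommGrpCat.{v} ℤ :=
  CochainComplex.HomComplex
    ((ChainComplex.cochainComplexEquivalence (ModuleCat.{v} R)).functor.obj P)
    ((ChainComplex.cochainComplexEquivalence (ModuleCat.{v} R)).functor.obj A)

/-- A complex is semi-projective if it consists of projective modules and its total Hom functor
preserves acyclicity. -/
def IsSemiProjective {R : Type u} [Ring R] (P : ChainComplex (ModuleCat.{v} R) ℤ) : Prop :=
  (∀ i : ℤ, Module.Projective R (P.X i)) ∧
    ∀ A : ChainComplex (ModuleCat.{v} R) ℤ, A.Acyclic → (totalHom P A).Acyclic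

/-- `f : P → M` is a semi-projective resolution of `M`. -/
def IsSemiProjectiveResolution {R : Type u} [Ring R] {P M : ChainComplex (ModuleCat.{v} R) ℤ}
    (f : P ⟶ M) : Prop :=
  IsSemiProjective P ∧ QuasiIso f

/-- `sup {i | L_i ≠ 0}` in `ℤ ∪ {-∞, ∞}`; it is `-∞` for the zero complex and `∞` if
`L_i ≠ 0` for arbitrarily large `i`. -/
noncomputable def supDegree {R : Type u} [Ring R] (L : ChainComplex (ModuleCat.{v} R) ℤ) :
    WithBot (WithTop ℤ) :=
  sSup {n | ∃ i : ℤ, ¬ IsZero (L.X i) ∧ n = ((i : WithTop ℤ) : WithBot (WithTop ℤ))}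

/-- The projective dimension of a complex: the infimum in `ℤ ∪ {-∞, ∞}` of the integers `n` such
that `M` has a semi-projective resolution `P → M` with `P_i = 0` for all `i > n`. -/
noncomputable def projDim {R : Type u} [Ring R] (M : ChainComplex (ModuleCat.{v} R) ℤ) :
    WithBot (WithTop ℤ) :=
  sInf {x | ∃ n : ℤ, x = ((n : WithTop ℤ) : WithBot (WithTop ℤ)) ∧
    ∃ (P : ChainComplex (ModuleCat.{v} R) ℤ) (f : P ⟶ M),
      IsSemiProjectiveResolution f ∧ ∀ i : ℤ, n < i → IsZero (P.X i)}

/-- Every term of the complex is a finitely generated module. -/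
def IsDegreewiseFG {R : Type u} [Ring R] (L : ChainComplex (ModuleCat.{v} R) ℤ) : Prop :=
  ∀ i : ℤ, Module.Finite R (L.X i)

end PureMin

/-! For degreewise finitely generated complexes over a left noetherian ring, pure-minimal means
having no nonzero contractible direct summand. A contractible summand is always a pure-acyclic pure
subcomplex. Conversely, such a subcomplex `Q` of `L` has finitely presented cycles and quotient
modules, so purity supplies a contraction of `Q` and degreewise splittings of `L → L/Q`; together
these make `Q` a contractible summand.

Contractible summands are encoded by special families `h`, with `h d h = h` and `h h = 0`: then `p =
d h + h d` is a null-homotopic idempotent chain map. Existence: take a bounded below resolution by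
finitely generated projectives (`exists_fg_resolution`) and split off a maximal contractible
summand, obtained from Zorn's lemma and the noetherian condition in each degree
(`exists_minimal_summand`).

For the dimension formula, `L` itself gives `pd M ≤ sup`. If another semi-projective resolution `P`
vanishes above `n`, then `L` and `P` are homotopy equivalent, so `L` is contractible above degree
`n`; the special family built from that partial contraction must vanish, and so must `L` above `n`
(`IsPureMinimal.isZero_of_homotopy`). -/

namespace PureMin

variable {R : Type u} [Ring R]

/-! ### Contractible summands and special families -/

/-- A contractible complex of modules is pure-acyclic. -/
lemma isPureAcyclic_of_homotopy {C : ChainComplex (ModuleCat.{v} R) ℤ}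
    (H : Homotopy (𝟙 C) 0) : IsPureAcyclic C := by
  have key (i : ℤ) : C.d i (i - 1) ≫ H.hom (i - 1) i + H.hom i (i + 1) ≫ C.d (i + 1) i =
      𝟙 (C.X i) := by
    have h := H.comm i
    rw [dNext_eq H.hom (show (ComplexShape.down ℤ).Rel i (i - 1) by simp),
      prevD_eq H.hom (show (ComplexShape.down ℤ).Rel (i + 1) i by simp)] at h
    simpa using h.symm
  have hw (i : ℤ) : (H.hom i (i + 1) ≫ C.d (i + 1) i) ≫ C.d i (i - 1) = 0 := by simp
  have f_r (i : ℤ) : C.iCycles i ≫ C.liftCycles _ (i - 1) (by simp) (hw i) = 𝟙 _ := by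
    rw [← cancel_mono (C.iCycles i)]
    simpa using C.iCycles i ≫= key i
  have s_g (i : ℤ) : (C.iCycles (i - 1) ≫ H.hom (i - 1) i) ≫ C.toCycles i (i - 1) = 𝟙 _ := by
    rw [← cancel_mono (C.iCycles (i - 1))]
    have h := C.iCycles (i - 1) ≫= key (i - 1)
    have e : H.hom (i - 1) (i - 1 + 1) ≫ C.d (i - 1 + 1) (i - 1) =
        H.hom (i - 1) i ≫ C.d i (i - 1) := by
      rw [sub_add_cancel]
    rw [e] at h
    simpa using h
  have hid (i : ℤ) : C.liftCycles _ (i - 1) (by simp) (hw i) ≫ C.iCycles i +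
      C.toCycles i (i - 1) ≫ C.iCycles (i - 1) ≫ H.hom (i - 1) i = 𝟙 _ := by
    have h := key i
    rw [add_comm] at h
    simpa using h
  -- The homotopy splits each cycle sequence, and additive functors such as `Hom(A, -)` preserve
  -- split exact sequences.
  have spl (i : ℤ) : (cyclesSequence C i).Splitting := ⟨_, _, f_r i, s_g i, hid i⟩
  refine ⟨fun i => ?_, fun i => ⟨(spl i).shortExact, fun A _ => ((spl i).map _).shortExact⟩⟩
  rw [C.exactAt_iff' (i + 1) i (i - 1) (by simp) (by simp),
    ShortComplex.moduleCat_exact_iff]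
  intro x hx
  refine ⟨(H.hom i (i + 1)).hom x, ?_⟩
  have h : (C.d i (i - 1)).hom x = 0 := hx
  have e : (H.hom (i - 1) i).hom ((C.d i (i - 1)).hom x) +
      (C.d (i + 1) i).hom ((H.hom i (i + 1)).hom x) = x := ConcreteCategory.congr_hom (key i) x
  rw [h, map_zero, zero_add] at e
  exact e

/-- The quotient sequence of a split monomorphism of complexes is pure exact. -/
lemma pureShortExactComplex_of_retraction {L M : ChainComplex (ModuleCat.{v} R) ℤ} (j : L ⟶ M)
    (r : M ⟶ L) (h : j ≫ r = 𝟙 L) : PureShortExactComplex (quotientSequence j) := by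
  have hw : j ≫ (𝟙 M - r ≫ j) = 0 := by simp [reassoc_of% h]
  have s_g : cokernel.desc j _ hw ≫ cokernel.π j = 𝟙 _ := by
    rw [← cancel_epi (cokernel.π j), cokernel.π_desc_assoc]
    simp
  have hid : r ≫ j + cokernel.π j ≫ cokernel.desc j _ hw = 𝟙 _ := by
    rw [cokernel.π_desc]
    simp
  let spl : (quotientSequence j).Splitting := ⟨r, _, h, s_g, hid⟩
  exact ⟨spl.shortExact, fun A _ => (spl.map _).shortExact⟩

/-- A family of maps `h` of degree one with `h d h = h` and `h h = 0`: it splits off the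
contractible direct summand of the complex that is the image of `d h + h d`. -/
def IsSpecial {C : ChainComplex (ModuleCat.{v} R) ℤ} (h : ∀ i : ℤ, C.X i ⟶ C.X (i + 1)) : Prop :=
  ∀ i : ℤ, h i ≫ C.d (i + 1) i ≫ h i = h i ∧ h i ≫ h (i + 1) = 0

/-- The null-homotopic chain map `d h + h d`. -/
noncomputable def nullMap {C : ChainComplex (ModuleCat.{v} R) ℤ}
    (h : ∀ i : ℤ, C.X i ⟶ C.X (i + 1)) : C ⟶ C :=
  Homotopy.nullHomotopicMap' fun i _ hij => h i ≫ eqToHom (congrArg C.X hij)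

lemma nullMap_f {C : ChainComplex (ModuleCat.{v} R) ℤ} (h : ∀ i : ℤ, C.X i ⟶ C.X (i + 1)) (i : ℤ) :
    (nullMap h).f (i + 1) = C.d (i + 1) i ≫ h i + h (i + 1) ≫ C.d (i + 1 + 1) (i + 1) := by
  rw [nullMap, Homotopy.nullHomotopicMap'_f (k₂ := i + 1 + 1) (k₀ := i) (by simp) (by simp)]
  simp

/-- The map `d h + h d` is null-homotopic. -/
noncomputable def nullMapHomotopy {C : ChainComplex (ModuleCat.{v} R) ℤ}
    (h : ∀ i : ℤ, C.X i ⟶ C.X (i + 1)) : Homotopy (nullMap h) 0 :=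
  Homotopy.nullHomotopy' _

/-- Every integer is a successor, so the formula `nullMap_f`, available only in degrees `i + 1`,
suffices to compare chain maps without index transport. -/
lemma hom_ext_succ {C D : ChainComplex (ModuleCat.{v} R) ℤ} {f g : C ⟶ D}
    (h : ∀ i : ℤ, f.f (i + 1) = g.f (i + 1)) : f = g := by
  ext1 i
  obtain ⟨k, rfl⟩ : ∃ k : ℤ, i = k + 1 := ⟨i - 1, by simp⟩
  exact h k

namespace IsSpecial

variable {C : ChainComplex (ModuleCat.{v} R) ℤ} {h : ∀ i : ℤ, C.X i ⟶ C.X (i + 1)}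

lemma comp_nullMap (hh : IsSpecial h) (i : ℤ) : h i ≫ (nullMap h).f (i + 1) = h i := by
  rw [nullMap_f, Preadditive.comp_add, (hh i).1, reassoc_of% (hh i).2, zero_comp, add_zero]

lemma nullMap_comp (hh : IsSpecial h) (i : ℤ) : (nullMap h).f i ≫ h i = h i := by
  obtain ⟨k, rfl⟩ : ∃ k : ℤ, i = k + 1 := ⟨i - 1, by simp⟩
  rw [nullMap_f, Preadditive.add_comp, Category.assoc, Category.assoc, (hh k).2, (hh (k + 1)).1,
    comp_zero, zero_add]

lemma nullMap_idem (hh : IsSpecial h) : nullMap h ≫ nullMap h = nullMap h := by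
  refine hom_ext_succ fun i => ?_
  rw [HomologicalComplex.comp_f]
  conv_lhs => arg 1; rw [nullMap_f]
  rw [Preadditive.add_comp, Category.assoc, Category.assoc, hh.comp_nullMap,
    ← (nullMap h).comm, reassoc_of% (hh.comp_nullMap (i + 1)), ← nullMap_f]

end IsSpecial

/-- A pure-minimal complex has no contractible direct summand. -/
lemma IsPureMinimal.eq_zero_of_isSpecial {L : ChainComplex (ModuleCat.{v} R) ℤ}
    (hL : IsPureMinimal L) {h : ∀ i : ℤ, L.X i ⟶ L.X (i + 1)} (hh : IsSpecial h) (i : ℤ) :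
    h i = 0 := by
  obtain ⟨Q, j, r, hjr, hrj⟩ :=
    IsIdempotentComplete.idempotents_split L (nullMap h) hh.nullMap_idem
  -- The identity of `Q` is `j ≫ p ≫ r` with `p = nullMap h`, and `p` is null-homotopic.
  have H : Homotopy (𝟙 Q) 0 :=
    (Homotopy.ofEq (by rw [← hrj]; simp [hjr])).trans
      ((((nullMapHomotopy h).compRight r).compLeft j).trans (Homotopy.ofEq (by simp)))
  have hz : IsZero Q := hL Q j ⟨fun a b hab => by
      simpa [hjr] using hab =≫ r⟩
    (pureShortExactComplex_of_retraction j r hjr) (isPureAcyclic_of_homotopy H)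
  rw [← hh.nullMap_comp i, ← hrj, hz.eq_of_tgt r 0]
  simp

/-! ### Pure subcomplexes of degreewise finitely generated complexes -/

/-- Purity of complexes passes to the sequences of modules in each degree, by testing with
disk complexes. -/
lemma exists_degreewise_section {L M : ChainComplex (ModuleCat.{v} R) ℤ} (j : L ⟶ M)
    (hj : PureShortExactComplex (quotientSequence j)) (i : ℤ)
    [Module.FinitePresentation R ((cokernel j).X i)] :
    ∃ s : (cokernel j).X i ⟶ M.X i, s ≫ (cokernel.π j).f i = 𝟙 _ := by
  have hi : (ComplexShape.down ℤ).Rel i (i - 1) := by simp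
  have hne : i ≠ i - 1 := by omega
  let A := (cokernel j).X i
  let D := HomologicalComplex.double (𝟙 A) hi
  -- Chain maps from the disk `D` to `X` are maps `A ⟶ X.X i`, so lifting the chain map that
  -- corresponds to `𝟙 A` yields the section.
  let E := HomologicalComplex.evalCompCoyonedaCorepresentableByDoubleId hi hne A
  have hD : IsBoundedFinPres D := by
    refine ⟨⟨i - 1, i, fun k hk => HomologicalComplex.isZero_double_X _ _ _ (by omega) (by omega)⟩,
      fun k => ?_⟩
    by_cases h₀ : k = i
    · subst h₀
      exact Module.FinitePresentation.of_equiv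
        (HomologicalComplex.doubleXIso₀ (𝟙 A) hi).symm.toLinearEquiv
    · by_cases h₁ : k = i - 1
      · subst h₁
        exact Module.FinitePresentation.of_equiv
          (HomologicalComplex.doubleXIso₁ (𝟙 A) hi hne).symm.toLinearEquiv
      · have := ModuleCat.subsingleton_of_isZero
          (HomologicalComplex.isZero_double_X (𝟙 A) hi k h₀ h₁)
        infer_instance
  have hsurj := (hj.2 D hD).epi_g
  rw [AddCommGrpCat.epi_iff_surjective] at hsurj
  obtain ⟨g, hg⟩ := hsurj (E.homEquiv.symm (𝟙 A))
  have hg' : (show D ⟶ M from g) ≫ cokernel.π j = E.homEquiv.symm (𝟙 A) := hg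
  refine ⟨E.homEquiv (show D ⟶ M from g), ?_⟩
  have := E.homEquiv_comp (cokernel.π j) (show D ⟶ M from g)
  rw [hg'] at this
  exact this.symm.trans (E.homEquiv.apply_symm_apply _)

/-- A pure-acyclic complex of finitely presented cycle modules is contractible. -/
lemma IsPureAcyclic.exists_contraction {C : ChainComplex (ModuleCat.{v} R) ℤ}
    (hC : IsPureAcyclic C) [∀ i, Module.FinitePresentation R (C.cycles i)] :
    ∃ s : ∀ i : ℤ, C.X i ⟶ C.X (i + 1), ∀ i : ℤ,
      C.d (i + 1) i ≫ s i + s (i + 1) ≫ C.d (i + 1 + 1) (i + 1) = 𝟙 _ := by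
  have hσ (i j : ℤ) (hij : j + 1 = i) :
      ∃ σ : C.cycles j ⟶ C.X i, σ ≫ C.toCycles i j = 𝟙 _ := by
    obtain rfl : j = i - 1 := by omega
    have h := ((hC.2 i).2 (C.cycles (i - 1)) inferInstance).epi_g
    rw [AddCommGrpCat.epi_iff_surjective] at h
    obtain ⟨σ, hσ⟩ := h (𝟙 (C.cycles (i - 1)))
    exact ⟨σ, hσ⟩
  choose σ hσ using hσ
  have hσd (i j : ℤ) (hij : j + 1 = i) : σ i j hij ≫ C.d i j = C.iCycles j := by
    rw [← C.toCycles_i i j, reassoc_of% (hσ i j hij)]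
  have hw (i : ℤ) : (𝟙 (C.X i) - C.toCycles i (i - 1) ≫ σ i (i - 1) (by simp)) ≫
      C.d i (i - 1) = 0 := by
    rw [Preadditive.sub_comp, Category.assoc, hσd, C.toCycles_i, Category.id_comp, sub_self]
  let τ (i : ℤ) : C.X i ⟶ C.cycles i := C.liftCycles _ (i - 1) (by simp) (hw i)
  have hiτ (i : ℤ) : C.iCycles i ≫ τ i = 𝟙 _ := by
    rw [← cancel_mono (C.iCycles i), Category.assoc, C.liftCycles_i, Preadditive.comp_sub,
      ← Category.assoc]
    have : C.iCycles i ≫ C.toCycles i (i - 1) = 0 := by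
      rw [← cancel_mono (C.iCycles _)]
      simp
    simp [this]
  -- Retract onto the cycles, then lift one degree up: `s ≫ d` is the projection `τ ≫ iCycles` and
  -- `d ≫ s` is the complementary one, `toCycles ≫ σ`.
  refine ⟨fun i => τ i ≫ σ (i + 1) i rfl, fun i => ?_⟩
  have h₁ : C.d (i + 1) i ≫ τ i = C.toCycles (i + 1) i := by
    rw [← C.toCycles_i (i + 1) i, Category.assoc, hiτ, Category.comp_id]
  have h₂ : ∀ k (hk : k + 1 = i + 1), C.toCycles (i + 1) k ≫ σ (i + 1) k hk =
      C.toCycles (i + 1) i ≫ σ (i + 1) i rfl := by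
    intro k hk
    obtain rfl : k = i := by omega
    rfl
  rw [reassoc_of% h₁, Category.assoc, hσd, C.liftCycles_i, h₂ (i + 1 - 1) (by simp), add_sub_cancel]

/-- A degreewise finitely generated complex over a noetherian ring without contractible direct
summands is pure-minimal. -/
lemma isPureMinimal_of_isSpecial [IsNoetherianRing R] {L : ChainComplex (ModuleCat.{v} R) ℤ}
    (hfg : IsDegreewiseFG L)
    (hL : ∀ h : ∀ i : ℤ, L.X i ⟶ L.X (i + 1), IsSpecial h → ∀ i, h i = 0) :
    IsPureMinimal L := by
  intro Q j hj hpure hQ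
  have (i : ℤ) : Module.Finite R (L.X i) := hfg i
  have hmono (i : ℤ) : Mono (j.f i) := inferInstance
  have (i : ℤ) : Module.Finite R (Q.X i) :=
    Module.Finite.of_injective (j.f i).hom ((ModuleCat.mono_iff_injective _).1 (hmono i))
  have (i : ℤ) : Module.Finite R (Q.cycles i) :=
    Module.Finite.of_injective (Q.iCycles i).hom
      ((ModuleCat.mono_iff_injective _).1 inferInstance)
  have (i : ℤ) : Module.Finite R ((cokernel j).X i) :=
    Module.Finite.of_surjective ((cokernel.π j).f i).hom
      ((ModuleCat.epi_iff_surjective _).1 inferInstance)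
  have (i : ℤ) : Module.FinitePresentation R ((cokernel j).X i) :=
    Module.finitePresentation_of_finite R _
  have (i : ℤ) : Module.FinitePresentation R (Q.cycles i) :=
    Module.finitePresentation_of_finite R _
  have hρ (i : ℤ) : ∃ ρ : L.X i ⟶ Q.X i, j.f i ≫ ρ = 𝟙 _ := by
    obtain ⟨s, hs⟩ := exists_degreewise_section j hpure i
    have hS := hpure.1.map_of_exact (HomologicalComplex.eval _ _ i)
    let spl := ShortComplex.Splitting.ofExactOfSection _ hS.exact s hs (hmono i)
    exact ⟨spl.r, spl.f_r⟩
  choose ρ hρ using hρ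
  obtain ⟨s, hs⟩ := hQ.exists_contraction
  have dsd (i : ℤ) : Q.d (i + 1) i ≫ s i ≫ Q.d (i + 1) i = Q.d (i + 1) i := by
    simpa using hs i =≫ Q.d (i + 1) i
  have dssd (i : ℤ) : Q.d (i + 1) i ≫ s i ≫ s (i + 1) ≫ Q.d (i + 1 + 1) (i + 1) = 0 := by
    have h := (Q.d (i + 1) i ≫ s i) ≫= hs i
    simpa [reassoc_of% (dsd i)] using h
  -- The contraction `s` need not square to zero; `s d s` does.
  let t (i : ℤ) : Q.X i ⟶ Q.X (i + 1) := s i ≫ Q.d (i + 1) i ≫ s i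
  -- The retractions `ρ` need not commute with `d`; only `j` has to be a chain map for `h` to be
  -- special.
  let h (i : ℤ) : L.X i ⟶ L.X (i + 1) := ρ i ≫ t i ≫ j.f (i + 1)
  have hh : IsSpecial h := by
    intro i
    have e₁ : t i ≫ Q.d (i + 1) i ≫ t i = t i := by
      simp only [t, Category.assoc]
      rw [reassoc_of% (dsd i), reassoc_of% (dsd i)]
    have e₂ : t i ≫ t (i + 1) = 0 := by
      simp only [t, Category.assoc]
      rw [reassoc_of% (dssd i), zero_comp, comp_zero]
    constructor
    · simp only [h, Category.assoc]
      rw [j.comm_assoc, reassoc_of% (hρ i), reassoc_of% e₁]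
    · simp only [h, Category.assoc]
      rw [reassoc_of% (hρ (i + 1)), reassoc_of% e₂, zero_comp, comp_zero]
  have ht (i : ℤ) : t i = 0 := by
    have := j.f i ≫= hL h hh i
    rw [comp_zero] at this
    simp only [h] at this
    rw [reassoc_of% (hρ i), ← zero_comp (f := j.f (i + 1)), cancel_mono] at this
    exact this
  have h1 : 𝟙 Q = 0 := by
    refine hom_ext_succ fun i => ?_
    have hd : Q.d (i + 1) i = 0 := by
      have : Q.d (i + 1) i ≫ t i ≫ Q.d (i + 1) i = Q.d (i + 1) i := by
        simp only [t, Category.assoc]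
        rw [dsd, dsd]
      rw [← this, ht, zero_comp, comp_zero]
    have hd' : Q.d (i + 1 + 1) (i + 1) = 0 := by
      have : Q.d (i + 1 + 1) (i + 1) ≫ t (i + 1) ≫ Q.d (i + 1 + 1) (i + 1) =
          Q.d (i + 1 + 1) (i + 1) := by
        simp only [t, Category.assoc]
        rw [dsd, dsd]
      rw [← this, ht, zero_comp, comp_zero]
    have := hs i
    rw [hd, hd', zero_comp, comp_zero, add_zero] at this
    simpa using this.symm
  exact (IsZero.iff_id_eq_zero Q).2 h1

end PureMin

/-! ### Splitting off a maximal contractible summand -/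

namespace PureMin

variable {R : Type u} [Ring R]

/-- The relation on special families that corresponds to inclusion of the contractible summands
they split off. -/
def SpecialLE {C : ChainComplex (ModuleCat.{v} R) ℤ} (h k : ∀ i : ℤ, C.X i ⟶ C.X (i + 1)) : Prop :=
  ∀ i : ℤ, h i ≫ C.d (i + 1) i ≫ k i = h i ∧ k i ≫ C.d (i + 1) i ≫ h i = h i

lemma SpecialLE.trans {C : ChainComplex (ModuleCat.{v} R) ℤ}
    {h k l : ∀ i : ℤ, C.X i ⟶ C.X (i + 1)} (h₁ : SpecialLE h k) (h₂ : SpecialLE k l) :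
    SpecialLE h l := by
  intro i
  constructor
  · rw [← (h₁ i).1]
    simp only [Category.assoc]
    rw [(h₂ i).1]
  · rw [← (h₁ i).2]
    rw [reassoc_of% (h₂ i).2]

/-- A noetherian complex has a maximal special family. -/
lemma exists_maximal_isSpecial (C : ChainComplex (ModuleCat.{v} R) ℤ)
    [hC : ∀ i, IsNoetherian R (C.X i)] :
    ∃ h : ∀ i : ℤ, C.X i ⟶ C.X (i + 1), IsSpecial h ∧
      ∀ k : ∀ i : ℤ, C.X i ⟶ C.X (i + 1), IsSpecial k → SpecialLE h k → SpecialLE k h := by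
  let S := { h : ∀ i : ℤ, C.X i ⟶ C.X (i + 1) // IsSpecial h }
  let r : S → S → Prop := fun h k => SpecialLE h.1 k.1
  have : Nonempty S := ⟨⟨fun _ => 0, fun i => by simp⟩⟩
  have refl (a : S) : r a a := fun i => ⟨(a.2 i).1, (a.2 i).1⟩
  suffices hb : ∀ c : Set S, IsChain r c → c.Nonempty → ∃ ub, ∀ a ∈ c, r a ub by
    obtain ⟨m, hm⟩ := exists_maximal_of_nonempty_chains_bounded hb
      (fun h₁ h₂ => SpecialLE.trans h₁ h₂)
    exact ⟨m.1, m.2, fun k hk h => hm ⟨k, hk⟩ h⟩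
  intro c hc hne
  -- Along the chain the ranges in degree `i` increase, hence stabilize; comparable members with
  -- equal ranges in degree `i` agree there.
  have hmax (i : ℤ) : ∃ a ∈ c, ∀ b ∈ c, r a b → b.1 i = a.1 i := by
    obtain ⟨N, ⟨a, ha, rfl⟩, hN⟩ := set_has_maximal_iff_noetherian.2 (hC (i + 1))
      ((fun a : S => LinearMap.range (a.1 i).hom) '' c) (hne.image _)
    refine ⟨a, ha, fun b hb hab => ?_⟩
    have hle : LinearMap.range (a.1 i).hom ≤ LinearMap.range (b.1 i).hom := by
      rintro _ ⟨x, rfl⟩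
      exact ⟨(C.d (i + 1) i).hom ((a.1 i).hom x), ConcreteCategory.congr_hom (hab i).1 x⟩
    have heq : LinearMap.range (a.1 i).hom = LinearMap.range (b.1 i).hom := by
      by_contra hn
      exact hN _ ⟨b, hb, rfl⟩ (lt_of_le_of_ne hle hn)
    ext x
    obtain ⟨y, hy⟩ : (b.1 i).hom x ∈ LinearMap.range (a.1 i).hom := heq ▸ ⟨x, rfl⟩
    have e₁ : (a.1 i).hom ((C.d (i + 1) i).hom ((a.1 i).hom y)) = (a.1 i).hom y :=
      ConcreteCategory.congr_hom (a.2 i).1 y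
    have e₂ : (a.1 i).hom ((C.d (i + 1) i).hom ((b.1 i).hom x)) = (a.1 i).hom x :=
      ConcreteCategory.congr_hom (hab i).2 x
    rw [← hy, e₁] at e₂
    exact hy.symm.trans e₂
  choose a hac ha using hmax
  -- Any two degrees of the limit family are realized by one member of the chain, so the condition
  -- `h h = 0` passes to the limit.
  have hup (i k : ℤ) : ∃ b ∈ c, b.1 i = (a i).1 i ∧ b.1 k = (a k).1 k := by
    by_cases h : a i = a k
    · exact ⟨a i, hac i, rfl, by rw [h]⟩
    · rcases hc (hac i) (hac k) h with h | h
      · exact ⟨a k, hac k, ha i _ (hac k) h, rfl⟩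
      · exact ⟨a i, hac i, rfl, ha k _ (hac i) h⟩
  refine ⟨⟨fun i => (a i).1 i, fun i => ⟨((a i).2 i).1, ?_⟩⟩, fun b hb i => ?_⟩
  · obtain ⟨b, -, h₁, h₂⟩ := hup i (i + 1)
    dsimp only
    rw [← h₁, ← h₂]
    exact (b.2 i).2
  · by_cases h : a i = b
    · subst h
      exact refl _ i
    · rcases hc (hac i) hb h with h | h
      · change b.1 i ≫ _ ≫ (a i).1 i = _ ∧ (a i).1 i ≫ _ ≫ _ = _
        rw [← ha i b hb h]
        exact refl b i
      · exact h i

/-- A noetherian complex is homotopy equivalent to a direct summand without contractible direct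
summands. -/
lemma exists_minimal_summand (C : ChainComplex (ModuleCat.{v} R) ℤ)
    [hC : ∀ i, IsNoetherian R (C.X i)] :
    ∃ (L : ChainComplex (ModuleCat.{v} R) ℤ) (ι : L ⟶ C) (π : C ⟶ L), ι ≫ π = 𝟙 L ∧
      Nonempty (Homotopy (π ≫ ι) (𝟙 C)) ∧
      ∀ h : ∀ i : ℤ, L.X i ⟶ L.X (i + 1), IsSpecial h → ∀ i, h i = 0 := by
  obtain ⟨h, hh, hmax⟩ := exists_maximal_isSpecial C
  have idem : (𝟙 C - nullMap h) ≫ (𝟙 C - nullMap h) = 𝟙 C - nullMap h := by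
    simp [hh.nullMap_idem]
  obtain ⟨L, ι, π, hιπ, hπι⟩ :=
    IsIdempotentComplete.idempotents_split C _ idem
  have H : Homotopy (𝟙 C) (𝟙 C - nullMap h) :=
    Homotopy.equivSubZero.symm ((Homotopy.ofEq (sub_sub_cancel _ _)).trans (nullMapHomotopy h))
  refine ⟨L, ι, π, hιπ, ⟨(Homotopy.ofEq hπι).trans H.symm⟩, fun k hk i => ?_⟩
  have e₀ (i : ℤ) : π.f i ≫ ι.f i = 𝟙 _ - (nullMap h).f i := by
    rw [← HomologicalComplex.comp_f, hπι]
    simp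
  have e₁ (i : ℤ) : ι.f i ≫ π.f i = 𝟙 _ := by
    rw [← HomologicalComplex.comp_f, hιπ]
    simp
  have hπ (i : ℤ) : h i ≫ π.f (i + 1) = 0 := by
    have : h i ≫ π.f (i + 1) ≫ ι.f (i + 1) = 0 := by
      rw [e₀, Preadditive.comp_sub, hh.comp_nullMap, Category.comp_id, sub_self]
    simpa [e₁] using this =≫ π.f (i + 1)
  have hι (i : ℤ) : ι.f i ≫ h i = 0 := by
    have : π.f i ≫ ι.f i ≫ h i = 0 := by
      rw [← Category.assoc, e₀, Preadditive.sub_comp, hh.nullMap_comp, Category.id_comp, sub_self]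
    simpa [reassoc_of% (e₁ i)] using ι.f i ≫= this
  -- A special family on the complement is transported to `C`, where it is orthogonal to `h`; hence
  -- `h + k'` is special and lies above `h`, and maximality forces `k' = 0`.
  let k' (i : ℤ) : C.X i ⟶ C.X (i + 1) := π.f i ≫ k i ≫ ι.f (i + 1)
  have hk₁ (i : ℤ) : h i ≫ C.d (i + 1) i ≫ k' i = 0 := by
    simp only [k']
    rw [← π.comm_assoc, reassoc_of% (hπ i), zero_comp]
  have hk₂ (i : ℤ) : k' i ≫ C.d (i + 1) i ≫ h i = 0 := by
    simp only [k', Category.assoc]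
    rw [ι.comm_assoc, hι, comp_zero, comp_zero, comp_zero]
  have hk₃ (i : ℤ) : k' i ≫ C.d (i + 1) i ≫ k' i = k' i := by
    simp only [k', Category.assoc]
    rw [ι.comm_assoc, reassoc_of% (e₁ i), reassoc_of% (hk i).1]
  have hk₄ (i : ℤ) : h i ≫ k' (i + 1) = 0 := by
    simp only [k']
    rw [reassoc_of% (hπ i), zero_comp]
  have hk₅ (i : ℤ) : k' i ≫ h (i + 1) = 0 := by
    simp only [k', Category.assoc]
    rw [hι, comp_zero, comp_zero]
  have hk₆ (i : ℤ) : k' i ≫ k' (i + 1) = 0 := by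
    simp only [k', Category.assoc]
    rw [reassoc_of% (e₁ (i + 1)), reassoc_of% (hk i).2, zero_comp, comp_zero]
  have hs : IsSpecial (fun i => h i + k' i) := fun i => by
    simp [hk₁, hk₂, hk₃, hk₄, hk₅, hk₆, (hh i).1, (hh i).2]
  have hle : SpecialLE h (fun i => h i + k' i) := fun i => by
    simp [hk₁, hk₂, (hh i).1]
  have hk' : k' i = 0 := by
    have := (hmax _ hs hle i).1
    simpa [hk₂, (hh i).1] using this
  have := ι.f i ≫= hk' =≫ π.f (i + 1)
  simpa [k', e₁, reassoc_of% (e₁ i)] using this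

end PureMin

/-! ### K-projectivity and uniqueness of semi-projective resolutions -/

namespace PureMin

section

variable {C : Type*} [Category* C] [Abelian C]

/-- The cochain complex attached to a chain complex by the reindexing `i ↦ -i`. -/
noncomputable abbrev toCochain (K : ChainComplex C ℤ) : CochainComplex C ℤ :=
  (ChainComplex.cochainComplexEquivalence C).functor.obj K

/-- The map of cochain complexes attached to a map of chain complexes. -/
noncomputable abbrev toCochainMap {K L : ChainComplex C ℤ} (f : K ⟶ L) :
    toCochain K ⟶ toCochain L :=
  (ChainComplex.cochainComplexEquivalence C).functor.map f

lemma acyclic_toCochain {K : ChainComplex C ℤ} (hK : K.Acyclic) : (toCochain K).Acyclic := by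
  intro n
  rw [HomologicalComplex.exactAt_iff' _ (n - 1) n (n + 1) (by simp) (by simp)]
  exact (K.exactAt_iff' (-(n - 1)) (-n) (-(n + 1)) (by simp; ring) (by simp; ring)).1 (hK (-n))

lemma acyclic_inverse {K : CochainComplex C ℤ} (hK : K.Acyclic) :
    ((ChainComplex.cochainComplexEquivalence C).inverse.obj K).Acyclic := by
  intro n
  rw [HomologicalComplex.exactAt_iff' _ (n + 1) n (n - 1) (by simp) (by simp)]
  exact (K.exactAt_iff' (-(n + 1)) (-n) (-(n - 1)) (by simp; ring) (by simp; ring)).1 (hK (-n))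

lemma quasiIso_toCochainMap {K L : ChainComplex C ℤ} (f : K ⟶ L) [QuasiIso f] :
    QuasiIso (toCochainMap f) where
  quasiIsoAt n := by
    rw [quasiIsoAt_iff' _ (n - 1) n (n + 1) (by simp) (by simp)]
    exact (quasiIsoAt_iff' f (-(n - 1)) (-n) (-(n + 1)) (by simp; ring) (by simp; ring)).1
      inferInstance

/-- A homotopy of maps of chain complexes from a family of maps indexed by the opposite
degrees. -/
noncomputable def homotopyOfNeg {K L : ChainComplex C ℤ} {f g : K ⟶ L}
    (k : ∀ p q : ℤ, K.X (-p) ⟶ L.X (-q)) (zero : ∀ p q, q + 1 ≠ p → k p q = 0)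
    (comm : ∀ n, f.f (-n) = K.d (-n) (-(n + 1)) ≫ k (n + 1) n +
      k n (n - 1) ≫ L.d (-(n - 1)) (-n) + g.f (-n)) : Homotopy f g where
  hom p q := (K.XIsoOfEq (neg_neg p).symm).hom ≫ k (-p) (-q) ≫ (L.XIsoOfEq (neg_neg q)).hom
  zero p q hpq := by
    rw [zero, zero_comp, comp_zero]
    simp only [ComplexShape.down_Rel] at hpq
    lia
  comm n := by
    obtain ⟨n, rfl⟩ : ∃ m : ℤ, n = -m := ⟨-n, by simp⟩
    -- Double negation on `ℤ` is not definitionally trivial, so `k` is transported along equalities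
    -- of indices.
    have H (p q p' q' : ℤ) (hp : p = p') (hq : q = q') :
        k p q = (K.XIsoOfEq (congrArg Neg.neg hp)).hom ≫ k p' q' ≫
          (L.XIsoOfEq (congrArg Neg.neg hq.symm)).hom := by
      subst hp hq
      simp
    rw [dNext_eq _ (i' := -(n + 1)) (by simp), prevD_eq _ (j' := -(n - 1)) (by simp; ring),
      H (- -(n + 1)) (- -n) (n + 1) n (by simp) (by simp),
      H (- -n) (- -(n - 1)) n (n - 1) (by simp) (by simp), comm n]
    simp

/-- A homotopy between the reindexed maps gives one between the maps of chain complexes. -/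
noncomputable def homotopyOfToCochain {K L : ChainComplex C ℤ} {f g : K ⟶ L}
    (h : Homotopy (toCochainMap f) (toCochainMap g)) : Homotopy f g :=
  homotopyOfNeg (fun p q => h.hom p q) (fun p q hpq => h.zero p q (by simpa using hpq))
    (fun n => by
      have := h.comm n
      rw [dNext_eq _ (i' := n + 1) (by simp), prevD_eq _ (j' := n - 1) (by simp)] at this
      exact this)

attribute [local instance] HasDerivedCategory.standard in
/-- Two K-projective complexes quasi-isomorphic to the same complex are homotopy equivalent. -/
lemma exists_homotopy_of_isKProjective {K L M : CochainComplex C ℤ} [K.IsKProjective]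
    [L.IsKProjective] (f : K ⟶ M) (g : L ⟶ M) [QuasiIso f] [QuasiIso g] :
    ∃ (α : K ⟶ L) (β : L ⟶ K), Nonempty (Homotopy (α ≫ β) (𝟙 K)) := by
  -- Out of a K-projective complex, morphisms in the homotopy and derived categories coincide, so
  -- the derived map `f g⁻¹` comes from a chain map.
  have lift {K L : CochainComplex C ℤ} [K.IsKProjective] [L.IsKProjective] (f : K ⟶ M)
      (g : L ⟶ M) [QuasiIso f] [QuasiIso g] : ∃ α : K ⟶ L,
        DerivedCategory.Q.map α = DerivedCategory.Q.map f ≫ inv (DerivedCategory.Q.map g) := by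
    obtain ⟨α, hα⟩ := (CochainComplex.IsKProjective.Qh_map_bijective K
      ((HomotopyCategory.quotient _ _).obj L)).surjective
        ((DerivedCategory.quotientCompQhIso C).hom.app K ≫ DerivedCategory.Q.map f ≫
          inv (DerivedCategory.Q.map g) ≫ (DerivedCategory.quotientCompQhIso C).inv.app L)
    obtain ⟨α, rfl⟩ := (HomotopyCategory.quotient _ _).map_surjective α
    refine ⟨α, ?_⟩
    have := (DerivedCategory.quotientCompQhIso C).hom.naturality α
    rw [← cancel_epi ((DerivedCategory.quotientCompQhIso C).hom.app K), ← this]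
    dsimp
    rw [hα]
    simp
  obtain ⟨α, hα⟩ := lift f g
  obtain ⟨β, hβ⟩ := lift g f
  refine ⟨α, β, ⟨HomotopyCategory.homotopyOfEq _ _
    ((CochainComplex.IsKProjective.Qh_map_bijective K _).injective ?_)⟩⟩
  have h1 : DerivedCategory.Q.map (α ≫ β) = DerivedCategory.Q.map (𝟙 K) := by
    simp [hα, hβ]
  have := (DerivedCategory.quotientCompQhIso C).hom.naturality (α ≫ β)
  rw [h1, ← (DerivedCategory.quotientCompQhIso C).hom.naturality (𝟙 K), cancel_mono] at this
  exact this

/-- The Hom complex from a K-projective complex to an acyclic complex is acyclic. -/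
lemma acyclic_homComplex {K L : CochainComplex C ℤ} [K.IsKProjective] (hL : L.Acyclic) :
    (CochainComplex.HomComplex K L).Acyclic := by
  intro n
  rw [HomologicalComplex.exactAt_iff_isZero_homology, AddCommGrpCat.isZero_iff_subsingleton]
  have hLn : HomotopyCategory.subcategoryAcyclic C
      ((HomotopyCategory.quotient _ _).obj (L⟦n⟧)) := by
    rw [← HomotopyCategory.quotient_obj_mem_subcategoryAcyclic_iff_acyclic] at hL
    exact ObjectProperty.prop_of_iso _
      (((HomotopyCategory.quotient C (.up ℤ)).commShiftIso n).symm.app L)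
      ((HomotopyCategory.subcategoryAcyclic C).le_shift n _ hL)
  have := CochainComplex.IsKProjective.leftOrthogonal K
  have : Subsingleton ((HomotopyCategory.quotient _ _).obj K ⟶
      (HomotopyCategory.quotient _ _).obj (L⟦n⟧)) := ⟨fun a b => by
    rw [this a hLn, this b hLn]⟩
  exact ((CochainComplex.HomComplex.homologyAddEquiv K L n).trans
    CochainComplex.HomComplex.CohomologyClass.homAddEquiv).injective.subsingleton

/-- A chain map is a 0-cocycle of the Hom complex; a degree `-1` cochain bounding it is a
null-homotopy. -/
lemma exists_homotopy_zero {K L : CochainComplex C ℤ}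
    (h : (CochainComplex.HomComplex K L).Acyclic) (f : K ⟶ L) : Nonempty (Homotopy f 0) := by
  have h := h 0
  rw [HomologicalComplex.exactAt_iff_isZero_homology, AddCommGrpCat.isZero_iff_subsingleton] at h
  have := (CochainComplex.HomComplex.homologyAddEquiv K L 0).symm.injective.subsingleton
  have h0 : CochainComplex.HomComplex.CohomologyClass.mk
    (CochainComplex.HomComplex.Cocycle.ofHom f) = 0 := Subsingleton.elim _ _
  rw [CochainComplex.HomComplex.CohomologyClass.mk_eq_zero_iff,
    CochainComplex.HomComplex.mem_coboundaries_iff _ (-1) (by simp)] at h0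
  obtain ⟨β, hβ⟩ := h0
  exact ⟨(CochainComplex.HomComplex.Cochain.equivHomotopy _ _).symm ⟨β, by simp [hβ]⟩⟩

/-- A complex is K-projective if the Hom complexes to acyclic complexes are exact. -/
lemma isKProjective_of_acyclic {K : CochainComplex C ℤ}
    (hK : ∀ A : ChainComplex C ℤ, A.Acyclic →
      (CochainComplex.HomComplex K (toCochain A)).Acyclic) : K.IsKProjective where
  nonempty_homotopy_zero {L} f hL := by
    -- Up to isomorphism every cochain complex is a reindexed chain complex, so the hypothesis
    -- covers all acyclic targets.
    let e := (ChainComplex.cochainComplexEquivalence C).counitIso.app L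
    obtain ⟨H⟩ := exists_homotopy_zero (hK _ (acyclic_inverse hL)) (f ≫ e.inv)
    exact ⟨(Homotopy.ofEq (by simp)).trans ((H.compRight e.hom).trans
      (Homotopy.ofEq (by simp)))⟩

end

variable {R : Type u} [Ring R]

lemma IsSemiProjective.isKProjective {P : ChainComplex (ModuleCat.{v} R) ℤ}
    (hP : IsSemiProjective P) : (toCochain P).IsKProjective :=
  isKProjective_of_acyclic hP.2

/-- Two semi-projective resolutions of the same complex are homotopy equivalent. -/
lemma exists_homotopy_of_isSemiProjectiveResolution {L P M : ChainComplex (ModuleCat.{v} R) ℤ}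
    {f : L ⟶ M} {g : P ⟶ M} (hf : IsSemiProjectiveResolution f)
    (hg : IsSemiProjectiveResolution g) :
    ∃ (α : L ⟶ P) (β : P ⟶ L), Nonempty (Homotopy (α ≫ β) (𝟙 L)) := by
  have := hf.1.isKProjective
  have := hg.1.isKProjective
  have := hf.2
  have := hg.2
  have := quasiIso_toCochainMap f
  have := quasiIso_toCochainMap g
  obtain ⟨α, β, ⟨H⟩⟩ := exists_homotopy_of_isKProjective (toCochainMap f) (toCochainMap g)
  let F := (ChainComplex.cochainComplexEquivalence (ModuleCat.{v} R)).functor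
  refine ⟨F.preimage α, F.preimage β, ⟨homotopyOfToCochain ((Homotopy.ofEq ?_).trans
    (H.trans (Homotopy.ofEq ?_)))⟩⟩
  · simp [toCochainMap, F]
  · simp [toCochainMap]

/-- A bounded below complex of projective modules is semi-projective. -/
lemma isSemiProjective_of_bounded {P : ChainComplex (ModuleCat.{max u v} R) ℤ}
    (hP : ∀ i, Module.Projective R (P.X i)) (a : ℤ) (ha : ∀ i < a, IsZero (P.X i)) :
    IsSemiProjective P := by
  refine ⟨hP, fun A hA => ?_⟩
  have : (toCochain P).IsStrictlyLE (-a) := by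
    rw [CochainComplex.isStrictlyLE_iff]
    intro i hi
    exact ha (-i) (by omega)
  have (n : ℤ) : Projective ((toCochain P).X n) :=
    (IsProjective.iff_projective (P.X (-n))).1 (hP (-n))
  have := CochainComplex.isKProjective_of_projective (toCochain P) (-a)
  exact acyclic_homComplex (acyclic_toCochain hA)

end PureMin

/-! ### Resolutions by finitely generated projective modules -/

namespace PureMin

section

variable {R : Type u} [Ring R]

lemma exists_iCycles_eq (K : ChainComplex (ModuleCat.{v} R) ℤ) {j k : ℤ} (hk : k + 1 = j)
    (x : K.X j) (hx : (K.d j k).hom x = 0) : ∃ c : K.cycles j, (K.iCycles j).hom c = x := by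
  have h := ShortComplex.exact_of_f_is_kernel (ShortComplex.mk (K.iCycles j) (K.d j k) (by simp))
    (K.cyclesIsKernel j k (by simp; omega))
  exact (ShortComplex.moduleCat_exact_iff _).1 h x hx

lemma exists_toCycles_eq (K : ChainComplex (ModuleCat.{v} R) ℤ) (j : ℤ)
    (c : K.cycles j) (hc : (K.homologyπ j).hom c = 0) :
    ∃ y : K.X (j + 1), (K.toCycles (j + 1) j).hom y = c := by
  have h := ShortComplex.exact_of_g_is_cokernel
    (ShortComplex.mk (K.toCycles (j + 1) j) (K.homologyπ j) (by simp))
    (K.homologyIsCokernel (j + 1) j (by simp))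
  exact (ShortComplex.moduleCat_exact_iff _).1 h c hc

lemma iCycles_injective (K : ChainComplex (ModuleCat.{v} R) ℤ) (j : ℤ) :
    Function.Injective (K.iCycles j).hom :=
  (ModuleCat.mono_iff_injective _).1 inferInstance

lemma homologyπ_surjective (K : ChainComplex (ModuleCat.{v} R) ℤ) (j : ℤ) :
    Function.Surjective (K.homologyπ j).hom :=
  (ModuleCat.epi_iff_surjective _).1 inferInstance

lemma iCycles_toCycles (K : ChainComplex (ModuleCat.{v} R) ℤ) (i j : ℤ) (y : K.X i) :
    (K.iCycles j).hom ((K.toCycles i j).hom y) = (K.d i j).hom y :=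
  ConcreteCategory.congr_hom (K.toCycles_i i j) y

lemma homologyπ_toCycles (K : ChainComplex (ModuleCat.{v} R) ℤ) (i j : ℤ) (y : K.X i) :
    (K.homologyπ j).hom ((K.toCycles i j).hom y) = 0 :=
  ConcreteCategory.congr_hom (K.toCycles_comp_homologyπ i j) y

/-- An elementwise criterion for a map to be a quasi-isomorphism in a degree. -/
lemma quasiIsoAt_of_forall {K L : ChainComplex (ModuleCat.{v} R) ℤ} (φ : K ⟶ L) {j k : ℤ}
    (hk : k + 1 = j)
    (inj : ∀ x : K.X j, (K.d j k).hom x = 0 → ∀ y : L.X (j + 1),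
      (φ.f j).hom x = (L.d (j + 1) j).hom y → ∃ w : K.X (j + 1), (K.d (j + 1) j).hom w = x)
    (surj : ∀ z : L.X j, (L.d j k).hom z = 0 → ∃ x : K.X j, (K.d j k).hom x = 0 ∧
      ∃ y : L.X (j + 1), (φ.f j).hom x = z + (L.d (j + 1) j).hom y) :
    QuasiIsoAt φ j := by
  have hi (c : K.cycles j) : (L.iCycles j).hom ((HomologicalComplex.cyclesMap φ j).hom c) =
      (φ.f j).hom ((K.iCycles j).hom c) :=
    ConcreteCategory.congr_hom (HomologicalComplex.cyclesMap_i φ j) c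
  have hp (c : K.cycles j) :
      (HomologicalComplex.homologyMap φ j).hom ((K.homologyπ j).hom c) =
      (L.homologyπ j).hom ((HomologicalComplex.cyclesMap φ j).hom c) :=
    ConcreteCategory.congr_hom (HomologicalComplex.homologyπ_naturality φ j) c
  have hd (c : K.cycles j) : (K.d j k).hom ((K.iCycles j).hom c) = 0 :=
    ConcreteCategory.congr_hom (K.iCycles_d j k) c
  have hdL (c : L.cycles j) : (L.d j k).hom ((L.iCycles j).hom c) = 0 :=
    ConcreteCategory.congr_hom (L.iCycles_d j k) c
  rw [quasiIsoAt_iff_isIso_homologyMap]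
  have hmono : Mono (HomologicalComplex.homologyMap φ j) := by
    rw [ModuleCat.mono_iff_injective]
    refine (injective_iff_map_eq_zero (HomologicalComplex.homologyMap φ j).hom).2 fun x hx => ?_
    obtain ⟨c, rfl⟩ := homologyπ_surjective K j x
    rw [hp] at hx
    obtain ⟨y, hy⟩ := exists_toCycles_eq L j _ hx
    obtain ⟨w, hw⟩ := inj _ (hd c) y (by rw [← hi, ← hy, iCycles_toCycles])
    have : (K.toCycles (j + 1) j).hom w = c :=
      iCycles_injective K j (by rw [iCycles_toCycles, hw])
    rw [← this, homologyπ_toCycles]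
  have hepi : Epi (HomologicalComplex.homologyMap φ j) := by
    rw [ModuleCat.epi_iff_surjective]
    intro z
    obtain ⟨c, rfl⟩ := homologyπ_surjective L j z
    obtain ⟨x, hx, y, hy⟩ := surj _ (hdL c)
    obtain ⟨b, rfl⟩ := exists_iCycles_eq K hk x hx
    refine ⟨(K.homologyπ j).hom b, (hp b).trans ?_⟩
    have : (HomologicalComplex.cyclesMap φ j).hom b = c + (L.toCycles (j + 1) j).hom y :=
      iCycles_injective L j (by rw [hi, hy, map_add, iCycles_toCycles])
    rw [this, map_add, homologyπ_toCycles, add_zero]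
  exact isIso_of_mono_of_epi _

end

variable {R : Type u} [Ring R]

/-- No minimality is meant: `F` is a finite free module, lifted to the universe of `N`. -/
lemma exists_projective_cover (N : Type (max u v)) [AddCommGroup N] [Module R N]
    [Module.Finite R N] : ∃ F : ModuleCat.{max u v} R, Module.Finite R F ∧
      Module.Projective R F ∧ ∃ p : F →ₗ[R] N, Function.Surjective p := by
  obtain ⟨n, p, hp⟩ := Module.Finite.exists_fin' R N
  let e : ULift.{max u v} (Fin n → R) ≃ₗ[R] (Fin n → R) := ULift.moduleEquiv
  exact ⟨ModuleCat.of R (ULift.{max u v} (Fin n → R)), Module.Finite.equiv e.symm,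
    Module.Projective.of_equiv e.symm, p ∘ₗ e.toLinearMap, hp.comp e.surjective⟩

/-- A finitely generated projective module that can serve as term in degree `i` of a resolution of
`M`, with its module of cycles. -/
structure Stage (M : ChainComplex (ModuleCat.{max u v} R) ℤ) (i : ℤ) where
  /-- the module -/
  X : ModuleCat.{max u v} R
  /-- its cycles -/
  Z : Submodule R X
  /-- the map to `M` -/
  f : X ⟶ M.X i
  finite : Module.Finite R X
  projective : Module.Projective R X
  d_f : ∀ z ∈ Z, ∀ j, (M.d i j).hom (f.hom z) = 0

/-- The map `d` makes `t` the term above `s` in a resolution of `M`. -/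
structure Stage.Extends {M : ChainComplex (ModuleCat.{max u v} R) ℤ} {i : ℤ} (s : Stage M i)
    (t : Stage M (i + 1)) (d : t.X ⟶ s.X) : Prop where
  mem : ∀ x, d.hom x ∈ s.Z
  ker : ∀ x, x ∈ t.Z ↔ d.hom x = 0
  comm : t.f ≫ M.d (i + 1) i = d ≫ s.f
  inj : ∀ z ∈ s.Z, ∀ m : M.X (i + 1), s.f.hom z = (M.d (i + 1) i).hom m → ∃ x, d.hom x = z
  surj : ∀ z : M.X (i + 1), (M.d (i + 1) i).hom z = 0 → ∃ x, d.hom x = 0 ∧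
    ∃ y : M.X (i + 1 + 1), t.f.hom x = z + (M.d (i + 1 + 1) (i + 1)).hom y

/-- The new term is `F₁ × F₂`. `F₁` covers the cycles `N` of `s` that become boundaries in `M`,
which are finitely generated since `R` is noetherian; killing them gives injectivity on homology in
degree `i`. `F₂` consists of cycles and covers the homology of `M` in degree `i + 1`, which gives
surjectivity there. -/
lemma Stage.exists_extends [IsNoetherianRing R] {M : ChainComplex (ModuleCat.{max u v} R) ℤ}
    {i : ℤ} [Module.Finite R (M.homology (i + 1))] (s : Stage M i) :
    ∃ (t : Stage M (i + 1)) (d : t.X ⟶ s.X), s.Extends t d := by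
  have := s.finite
  let K : Submodule R (s.X × M.X (i + 1)) :=
    s.Z.comap (LinearMap.fst R _ _) ⊓
      LinearMap.ker (s.f.hom ∘ₗ LinearMap.fst R _ _ - (M.d (i + 1) i).hom ∘ₗ LinearMap.snd R _ _)
  have hK (p : s.X × M.X (i + 1)) :
      p ∈ K ↔ p.1 ∈ s.Z ∧ s.f.hom p.1 = (M.d (i + 1) i).hom p.2 := by
    simp [K, sub_eq_zero]
  let N := K.map (LinearMap.fst R _ _)
  obtain ⟨F₁, hF₁, hF₁', p₁, hp₁⟩ := exists_projective_cover.{v} (R := R) N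
  obtain ⟨F₂, hF₂, hF₂', p₂, hp₂⟩ := exists_projective_cover.{v} (R := R) (M.homology (i + 1))
  -- An element of `K` pairs a cycle with a chosen bounding element of `M`; lifting `F₁` through `K`
  -- defines `d` and the map to `M` together, so they commute.
  have hKN : Function.Surjective ((LinearMap.fst R s.X (M.X (i + 1))).submoduleMap K) :=
    LinearMap.submoduleMap_surjective _ _
  obtain ⟨g₁, hg₁⟩ := Module.projective_lifting_property _ p₁ hKN
  obtain ⟨g₂, hg₂⟩ := Module.projective_lifting_property _ p₂ (homologyπ_surjective M (i + 1))
  let d : F₁ × F₂ →ₗ[R] s.X := LinearMap.fst R _ _ ∘ₗ K.subtype ∘ₗ g₁ ∘ₗ LinearMap.fst R _ _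
  let f : F₁ × F₂ →ₗ[R] M.X (i + 1) :=
    LinearMap.snd R _ _ ∘ₗ K.subtype ∘ₗ g₁ ∘ₗ LinearMap.fst R _ _ +
      (M.iCycles (i + 1)).hom ∘ₗ g₂ ∘ₗ LinearMap.snd R _ _
  have hd (x) : d x = (g₁ x.1).1.1 := rfl
  have hf (x) : f x = (g₁ x.1).1.2 + (M.iCycles (i + 1)).hom (g₂ x.2) := rfl
  have hi (c : M.cycles (i + 1)) : (M.d (i + 1) i).hom ((M.iCycles (i + 1)).hom c) = 0 :=
    ConcreteCategory.congr_hom (M.iCycles_d (i + 1) i) c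
  have hfd (x) : (M.d (i + 1) i).hom (f x) = s.f.hom (d x) := by
    rw [hf, hd, map_add, hi, add_zero, ((hK _).1 (g₁ x.1).2).2]
  refine ⟨⟨ModuleCat.of R (F₁ × F₂), LinearMap.ker d, ModuleCat.ofHom f, inferInstance,
    inferInstance, fun z hz j => ?_⟩, ModuleCat.ofHom d, ⟨fun x => ?_, fun x => Iff.rfl, ?_, ?_, ?_⟩⟩
  · by_cases hj : j = i
    · subst hj
      rw [LinearMap.mem_ker] at hz
      exact (hfd z).trans (by rw [hz, map_zero])
    · rw [M.shape _ _ (by simp; omega)]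
      rfl
  · exact ((hK _).1 (g₁ x.1).2).1
  · exact ModuleCat.hom_ext (LinearMap.ext hfd)
  · intro z hz m hm
    have hz' : z ∈ N := ⟨(z, m), (hK _).2 ⟨hz, hm⟩, rfl⟩
    obtain ⟨x, hx⟩ := hp₁ ⟨z, hz'⟩
    refine ⟨(x, 0), ?_⟩
    have := congrArg Subtype.val (LinearMap.congr_fun hg₁ x)
    rw [hx] at this
    exact this
  · intro z hz
    obtain ⟨c, rfl⟩ := exists_iCycles_eq M rfl z hz
    obtain ⟨x, hx⟩ := hp₂ ((M.homologyπ (i + 1)).hom c)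
    have hx' : (M.homologyπ (i + 1)).hom (g₂ x) = p₂ x := LinearMap.congr_fun hg₂ x
    obtain ⟨y, hy⟩ := exists_toCycles_eq M (i + 1) (g₂ x - c) (by rw [map_sub, hx', hx, sub_self])
    refine ⟨(0, x), ?_, y, ?_⟩
    · change d (0, x) = 0
      simp [hd]
    · change f (0, x) = _
      rw [hf, ← iCycles_toCycles, hy]
      simp

/-- The zero module as a stage. -/
def Stage.zero (M : ChainComplex (ModuleCat.{max u v} R) ℤ) (i : ℤ) : Stage M i where
  X := ModuleCat.of R PUnit
  Z := ⊤
  f := 0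
  finite := inferInstance
  projective := inferInstance
  d_f := by simp

lemma Stage.zero_extends {M : ChainComplex (ModuleCat.{max u v} R) ℤ} {i : ℤ}
    (h : IsZero (M.homology (i + 1))) : (Stage.zero M i).Extends (Stage.zero M (i + 1)) 0 where
  mem _ := trivial
  ker _ := ⟨fun _ => rfl, fun _ => trivial⟩
  comm := zero_comp.trans zero_comp.symm
  inj _ _ _ _ := ⟨0, rfl⟩
  surj z hz := by
    obtain ⟨c, rfl⟩ := exists_iCycles_eq M rfl z hz
    have := ModuleCat.subsingleton_of_isZero h
    obtain ⟨y, rfl⟩ := exists_toCycles_eq M (i + 1) c (Subsingleton.elim _ _)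
    refine ⟨0, rfl, -y, ?_⟩
    rw [map_neg, iCycles_toCycles, add_neg_cancel]
    exact map_zero _

/-- A complex with finitely generated homology, bounded below, over a left noetherian ring has a
bounded below resolution by finitely generated projective modules. -/
lemma exists_fg_resolution [IsNoetherianRing R] (M : ChainComplex (ModuleCat.{max u v} R) ℤ)
    (hfg : ∀ i : ℤ, Module.Finite R (M.homology i)) (a : ℤ)
    (ha : ∀ i < a, IsZero (M.homology i)) :
    ∃ (P : ChainComplex (ModuleCat.{max u v} R) ℤ) (φ : P ⟶ M), QuasiIso φ ∧
      (∀ i, Module.Finite R (P.X i)) ∧ (∀ i, Module.Projective R (P.X i)) ∧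
      ∀ i < a, IsZero (P.X i) := by
  let step (i : ℤ) (s : Stage M i) : Stage M (i + 1) := s.exists_extends.choose
  -- Zero stages up to degree `a - 1`, iterated extension from there on.
  let T (i : ℤ) : Stage M i := Int.inductionOn' (motive := Stage M) i (a - 1) (Stage.zero M _)
    (fun k _ s => step k s) (fun k _ _ => Stage.zero M _)
  have hT₀ (i : ℤ) (hi : i < a) : T i = Stage.zero M i := by
    by_cases h : i = a - 1
    · subst h
      exact Int.inductionOn'_self
    · obtain ⟨k, rfl⟩ : ∃ k, i = k - 1 := ⟨i + 1, by simp⟩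
      exact Int.inductionOn'_sub_one (by omega)
  have hT₁ (i : ℤ) (hi : a - 1 ≤ i) : T (i + 1) = step i (T i) := Int.inductionOn'_add_one hi
  have hT (i : ℤ) : ∃ d : (T (i + 1)).X ⟶ (T i).X, (T i).Extends (T (i + 1)) d := by
    by_cases hi : i + 1 < a
    · rw [hT₀ i (by omega), hT₀ (i + 1) hi]
      exact ⟨0, Stage.zero_extends (ha _ hi)⟩
    · rw [hT₁ i (by omega)]
      exact (T i).exists_extends.choose_spec
  choose d hd using hT
  have sq (i : ℤ) : d (i + 1) ≫ d i = 0 := by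
    ext x
    exact ((hd i).ker _).1 ((hd (i + 1)).mem x)
  let P : ChainComplex (ModuleCat.{max u v} R) ℤ := ChainComplex.of (fun i => (T i).X) d sq
  have hP (i : ℤ) : P.d (i + 1) i = d i := ChainComplex.of_d (fun i => (T i).X) d i
  let φ : P ⟶ M :=
    { f := fun i => (T i).f
      comm' := fun i j hij => by
        obtain rfl : j + 1 = i := hij
        rw [hP]
        exact (hd j).comm }
  refine ⟨P, φ, ⟨fun j => ?_⟩, fun i => (T i).finite, fun i => (T i).projective, fun i hi => ?_⟩
  -- In degree `i + 1`, surjectivity comes from extending stage `i` and injectivity from extending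
  -- stage `i + 1`.
  · obtain ⟨i, rfl⟩ : ∃ i, j = i + 1 := ⟨j - 1, by simp⟩
    refine quasiIsoAt_of_forall φ rfl ?_ ?_
    · rw [hP, hP]
      exact fun x hx y hy => (hd (i + 1)).inj x (((hd i).ker x).2 hx) y hy
    · rw [hP]
      exact fun z hz => (hd i).surj z hz
  · change IsZero (T i).X
    rw [hT₀ i hi]
    have : Subsingleton (Stage.zero M i).X := inferInstanceAs (Subsingleton PUnit)
    exact ModuleCat.isZero_of_subsingleton _

end PureMin

/-! ### Projective dimension and the main theorem -/

namespace PureMin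

/-- A pure-minimal complex homotopy dominated by a complex vanishing above degree `n` vanishes
above degree `n`. -/
lemma IsPureMinimal.isZero_of_homotopy {R : Type u} [Ring R]
    {L P : ChainComplex (ModuleCat.{v} R) ℤ} (hL : IsPureMinimal L) {α : L ⟶ P} {β : P ⟶ L}
    (H : Homotopy (α ≫ β) (𝟙 L)) {n : ℤ} (hP : ∀ i : ℤ, n < i → IsZero (P.X i)) (i : ℤ)
    (hi : n < i) : IsZero (L.X i) := by
  let s (i : ℤ) : L.X i ⟶ L.X (i + 1) := -H.hom i (i + 1)
  have hs (i : ℤ) (hi : n ≤ i) :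
      L.d (i + 1) i ≫ s i + s (i + 1) ≫ L.d (i + 1 + 1) (i + 1) = 𝟙 _ := by
    have h := H.comm (i + 1)
    rw [dNext_eq H.hom (show (ComplexShape.down ℤ).Rel (i + 1) i by simp),
      prevD_eq H.hom (show (ComplexShape.down ℤ).Rel (i + 1 + 1) (i + 1) by simp),
      HomologicalComplex.comp_f, (hP (i + 1) (by omega)).eq_of_tgt (α.f (i + 1)) 0, zero_comp,
      HomologicalComplex.id_f] at h
    simp only [s, Preadditive.comp_neg, Preadditive.neg_comp]
    rw [← neg_add, neg_eq_iff_add_eq_zero, ← h]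
  have dsd (i : ℤ) (hi : n ≤ i) : L.d (i + 1) i ≫ s i ≫ L.d (i + 1) i = L.d (i + 1) i := by
    simpa using hs i hi =≫ L.d (i + 1) i
  have dssd (i : ℤ) (hi : n ≤ i) :
      L.d (i + 1) i ≫ s i ≫ s (i + 1) ≫ L.d (i + 1 + 1) (i + 1) = 0 := by
    have h := (L.d (i + 1) i ≫ s i) ≫= hs i hi
    simpa [reassoc_of% (dsd i hi)] using h
  -- The cutoff is `n`, not `n + 1`: the contraction identity in degree `n + 1`, the first where `P`
  -- vanishes, involves `s n`.
  let t (i : ℤ) : L.X i ⟶ L.X (i + 1) := if n ≤ i then s i ≫ L.d (i + 1) i ≫ s i else 0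
  have ht (i : ℤ) (hi : n ≤ i) : t i = s i ≫ L.d (i + 1) i ≫ s i := if_pos hi
  have hspec : IsSpecial t := by
    intro i
    by_cases hi : n ≤ i
    · rw [ht i hi, ht (i + 1) (by omega)]
      simp only [Category.assoc]
      rw [reassoc_of% (dsd i hi), reassoc_of% (dsd i hi), reassoc_of% (dssd i hi), zero_comp,
        comp_zero]
      exact ⟨rfl, rfl⟩
    · simp [t, hi]
  have hd (i : ℤ) (hi : n ≤ i) : L.d (i + 1) i = 0 := by
    have h : L.d (i + 1) i ≫ t i ≫ L.d (i + 1) i = L.d (i + 1) i := by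
      rw [ht i hi]
      simp only [Category.assoc]
      rw [dsd i hi, dsd i hi]
    rw [← h, hL.eq_zero_of_isSpecial hspec, zero_comp, comp_zero]
  obtain ⟨k, rfl⟩ : ∃ k, i = k + 1 := ⟨i - 1, by simp⟩
  rw [IsZero.iff_id_eq_zero, ← hs k (by omega), hd k (by omega), hd (k + 1) (by omega), zero_comp,
    comp_zero, add_zero]

lemma isZero_of_supDegree_lt {R : Type u} [Ring R] {L : ChainComplex (ModuleCat.{v} R) ℤ} {i : ℤ}
    (h : supDegree L < ((i : WithTop ℤ) : WithBot (WithTop ℤ))) : IsZero (L.X i) := by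
  by_contra hi
  exact not_le_of_gt h (le_sSup ⟨i, hi, rfl⟩)

/-- The projective dimension is computed by a pure-minimal semi-projective resolution. -/
lemma projDim_eq_supDegree {R : Type u} [Ring R] {L M : ChainComplex (ModuleCat.{v} R) ℤ}
    {f : L ⟶ M} (hf : IsSemiProjectiveResolution f) (hL : IsPureMinimal L) :
    projDim M = supDegree L := by
  apply le_antisymm
  · have key (n : ℤ) (hn : supDegree L ≤ ((n : WithTop ℤ) : WithBot (WithTop ℤ))) :
        projDim M ≤ ((n : WithTop ℤ) : WithBot (WithTop ℤ)) :=
      sInf_le ⟨n, rfl, L, f, hf, fun i hi => isZero_of_supDegree_lt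
        (hn.trans_lt (WithBot.coe_lt_coe.2 (WithTop.coe_lt_coe.2 hi)))⟩
    -- If the supremum is `-∞`, every integer bounds `projDim M`, which is then neither `∞` nor an
    -- integer.
    induction hs : supDegree L using WithBot.recBotCoe with
    | bot =>
      rw [hs] at key
      induction hp : projDim M using WithBot.recBotCoe with
      | bot => exact le_rfl
      | coe p =>
        exfalso
        induction p using WithTop.recTopCoe with
        | top =>
          have := key 0 bot_le
          rw [hp, WithBot.coe_le_coe] at this
          exact WithTop.coe_ne_top (top_le_iff.1 this)
        | coe m =>
          have := key (m - 1) bot_le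
          rw [hp, WithBot.coe_le_coe, WithTop.coe_le_coe] at this
          omega
    | coe p =>
      induction p using WithTop.recTopCoe with
      | top => exact le_top
      | coe m => exact key m hs.le
  · refine sSup_le ?_
    rintro _ ⟨i, hi, rfl⟩
    refine le_sInf ?_
    rintro _ ⟨n, rfl, P, g, hg, hP⟩
    rw [WithBot.coe_le_coe, WithTop.coe_le_coe]
    by_contra hn
    obtain ⟨α, β, ⟨H⟩⟩ := exists_homotopy_of_isSemiProjectiveResolution hf hg
    exact hi (hL.isZero_of_homotopy H hP i (by omega))

/-- Existence of pure-minimal degreewise finitely generated semi-projective resolutions. -/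
lemma exists_pureMinimal_resolution {R : Type u} [Ring R] [IsNoetherianRing R]
    (M : ChainComplex (ModuleCat.{max u v} R) ℤ)
    (hfg : ∀ i : ℤ, Module.Finite R (M.homology i)) (a : ℤ)
    (ha : ∀ i < a, IsZero (M.homology i)) :
    ∃ (L : ChainComplex (ModuleCat.{max u v} R) ℤ) (f : L ⟶ M),
      IsSemiProjectiveResolution f ∧ IsPureMinimal L ∧ IsDegreewiseFG L := by
  obtain ⟨P, φ, hφ, hP₁, hP₂, hP₃⟩ := exists_fg_resolution M hfg a ha
  obtain ⟨L, ι, π, hιπ, ⟨H⟩, hL⟩ := exists_minimal_summand P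
  have hret (i : ℤ) : ι.f i ≫ π.f i = 𝟙 _ := by
    rw [← HomologicalComplex.comp_f, hιπ, HomologicalComplex.id_f]
  have hfin : IsDegreewiseFG L := fun i =>
    Module.Finite.of_surjective (π.f i).hom fun x =>
      ⟨(ι.f i).hom x, ConcreteCategory.congr_hom (hret i) x⟩
  have hproj (i : ℤ) : Module.Projective R (L.X i) :=
    Module.Projective.of_split (ι.f i).hom (π.f i).hom (congrArg ModuleCat.Hom.hom (hret i))
  have hzero (i : ℤ) (hi : i < a) : IsZero (L.X i) := by
    rw [IsZero.iff_id_eq_zero, ← hret, (hP₃ i hi).eq_of_tgt (ι.f i) 0, zero_comp]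
  -- The inclusion of the minimal summand is a homotopy equivalence, so composing it with `φ` still
  -- gives a resolution.
  let e : HomotopyEquiv L P := ⟨ι, π, Homotopy.ofEq hιπ, H⟩
  have : QuasiIso ι := e.quasiIso_hom
  exact ⟨L, ι ≫ φ, ⟨isSemiProjective_of_bounded hproj a hzero, inferInstance⟩,
    isPureMinimal_of_isSpecial hfin hL, hfin⟩

end PureMin

theorem mainTheorem7 {R : Type u} [Ring R] [IsNoetherianRing R]
    (M : ChainComplex (ModuleCat.{max u v} R) ℤ)
    (hfg : ∀ i : ℤ, Module.Finite R (M.homology i))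
    (hbdd : ∃ a : ℤ, ∀ i : ℤ, i < a → IsZero (M.homology i)) :
    (∃ (L : ChainComplex (ModuleCat.{max u v} R) ℤ) (f : L ⟶ M),
      PureMin.IsSemiProjectiveResolution f ∧ PureMin.IsPureMinimal L ∧
        PureMin.IsDegreewiseFG L) ∧
    ∀ (L : ChainComplex (ModuleCat.{max u v} R) ℤ) (f : L ⟶ M),
      PureMin.IsSemiProjectiveResolution f → PureMin.IsPureMinimal L →
        PureMin.IsDegreewiseFG L →
          PureMin.projDim M = PureMin.supDegree L := by
  obtain ⟨a, ha⟩ := hbdd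
  exact ⟨PureMin.exists_pureMinimal_resolution M hfg a ha,
    fun L f hf hL _ => PureMin.projDim_eq_supDegree hf hL⟩
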